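/- Let $n \ge 0$ and let $G = \langle x_1, \dots, x_{n+1} \mid r_1, \dots, r_n\rangle$ be a group given by a deficiency 1 presentation, where the $r_i$ are non-empty reduced words, and suppose that the group ring $\mathbb{Q}G$ has no non-trivial zero-divisors. Let $\phi\colon G \to \mathbb{Z}$ be a homomorphism; write $\phi$ also for the induced homomorphism on the free group $F(x_1,\dots,x_{n+1})$. *The invariant.* $\Sigma(G)$ is the Bieri–Neumann–Strebel invariant: the set of non-zero homomorphisms $\chi\colon G\to\mathbb{R}$ such that, for some finite generating set $S$ of $G$, the full subgraph of the Cayley graph of $G$ with respect to $S$ (edges joining $g$ and $gs$, $s \in S$) spanned by the vertices $g$ with $\chi(g) \ge 0$ is connected. *Lower sections.* For a word $w$ let $C_w$ be the cyclic graph with $|w|$ edges and a marked vertex whose consecutive edges, read clockwise from the marked vertex, spell $w$; each vertex is labelled by the prefix of $w$ read from the marked vertex to it. When $\phi(w)=0$, the values of $\phi$ on the vertex labels extend linearly over the edges to $\tilde\phi\colon C_w\to\mathbb{R}$. The lower section $L_\phi(w)$ is the set of points of $C_w$ at which $\tilde\phi$ is minimal. *Conditions.* The tuple $((r_1,\dots,r_n),\phi)$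 satisfies the *unique minimum condition* if the $r_i$ are cyclically reduced and, after possibly re-ordering the generators and the relators: $\phi(x_i)\ge 0$ for $i\le n$ and $\phi(x_{n+1})<0$; $\phi(r_i)=0$ for all $i$; and for each $i \le n$ the lower section $L_\phi(r_i)$ consists either of (V) a single vertex, one of whose adjacent edges is labelled $x_i^{\pm}$ and the other $x_{n+1}^{\pm}$, or of (E) a single edge labelled $x_i^{\pm}$ whose adjacent edges are both labelled $x_{n+1}^{\pm}$. It satisfies the *repeated minimum condition* if the same holds except at exactly one relator $r_j$, for which $L_\phi(r_j)$ consists either of exactly two vertices, each as in (V) with $i=j$, or of exactly two edges, each as in (E) with $i=j$. In the latter case the two minima have *opposite orientation* if, in the case of vertices, clockwise around $C_{r_j}$ one is preceded by $x_j^{\pm}$ and followed by $x_{n+1}^{\pm}$, while the other is preceded by $x_{n+1}^{\pm}$ and followed by $x_j^{\pm}$; respectively if, in the case of edges, one is labelled $x_j$ and the other $x_j^{-1}$. (Otherwise they are two occurrences of the same labelled configuration.) Their *base points* are the two vertices themselves, respectively the initial vertices of the two edges when these are directed so as to read $x_j$. *Statement.* 1. If $((r_1,\dots,r_n),\phi)$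 satisfies the unique minimum condition, then $\phi\in\Sigma(G)$. 2. If $((r_1,\dots,r_n),\phi)$ satisfies the repeated minimum condition, and, in case its two minima have opposite orientation, the labels of their base points represent different elements of $G$, then $\phi\notin\Sigma(G)$. -/

import Mathlib

/-- The Bieri-Neumann-Strebel invariant `Σ(G)`: the non-zero homomorphisms `χ : G → ℝ` such that,
for some finite generating set `S` of `G`, the full subgraph of the Cayley graph of `G`
(edges joining `g` and `g * s` for `s ∈ S`) spanned by the vertices `g` with `χ g ≥ 0`
is connected. -/
def BNSInvariant (G : Type*) [Group G] : Set (Additive G →+ ℝ) :=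
  {χ | χ ≠ 0 ∧ ∃ S : Set G, S.Finite ∧ Subgroup.closure S = ⊤ ∧
    ((SimpleGraph.mulCayley S).induce {g : G | 0 ≤ χ (Additive.ofMul g)}).Connected}

/-! Words in the alphabet `{x_a, x_a⁻¹ : a ∈ α}` are lists of pairs `(a, b)`, where `(a, true)` is
`x_a` and `(a, false)` is `x_a⁻¹`. The cyclic graph `C_w` of a word `w` has as vertices the
positions `p : Fin w.length`; the edge `p` joins the vertex `p` to the cyclically next vertex
and is labelled by the letter `w[p]`, so the marked vertex is `0` and the two edges
adjacent to the vertex `p` are `p` and its cyclic predecessor. -/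

namespace CyclicWord

variable {α : Type*}

/-- The label of a vertex of `C_w`: the prefix spelled from the marked vertex to it. -/
def label (w : List (α × Bool)) (p : Fin w.length) : FreeGroup α :=
  FreeGroup.mk (w.take p)

/-- The cyclically next vertex (or edge) of `C_w`. -/
def next (w : List (α × Bool)) (p : Fin w.length) : Fin w.length := finRotate w.length p

/-- The cyclically previous vertex (or edge) of `C_w`. -/
def prev (w : List (α × Bool)) (p : Fin w.length) : Fin w.length := (finRotate w.length).symm p

/-- The vertices of the lower section of `w`: those where `φ` of the label is minimal. -/
def lowerVertices (φ : Additive (FreeGroup α) →+ ℤ) (w : List (α × Bool)) :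
    Set (Fin w.length) :=
  {p | ∀ q, φ (Additive.ofMul (label w p)) ≤ φ (Additive.ofMul (label w q))}

/-- The edges of the lower section of `w`. As `φ` is extended linearly over edges, an edge
belongs to the lower section exactly if both its endpoints do, and otherwise no interior point
of it does. -/
def lowerEdges (φ : Additive (FreeGroup α) →+ ℤ) (w : List (α × Bool)) :
    Set (Fin w.length) :=
  {p | p ∈ lowerVertices φ w ∧ next w p ∈ lowerVertices φ w}

/-- One of the edges adjacent to the vertex `p` is labelled `x_a^±`, the other `x_b^±`. -/
def IsVertexOfType (a b : α) (w : List (α × Bool)) (p : Fin w.length) : Prop :=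
  ((w.get (prev w p)).1 = a ∧ (w.get p).1 = b) ∨ ((w.get (prev w p)).1 = b ∧ (w.get p).1 = a)

/-- The edge `p` is labelled `x_a^±`, and its adjacent edges are labelled `x_b^±`. -/
def IsEdgeOfType (a b : α) (w : List (α × Bool)) (p : Fin w.length) : Prop :=
  (w.get p).1 = a ∧ (w.get (prev w p)).1 = b ∧ (w.get (next w p)).1 = b

/-- The lower section of `w` consists of a single vertex or a single edge, of the given type. -/
def HasUniqueMinimum (φ : Additive (FreeGroup α) →+ ℤ) (a b : α) (w : List (α × Bool)) : Prop :=
  (∃ p, lowerVertices φ w = {p} ∧ lowerEdges φ w = ∅ ∧ IsVertexOfType a b w p) ∨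
  (∃ p, lowerVertices φ w = {p, next w p} ∧ lowerEdges φ w = {p} ∧ IsEdgeOfType a b w p)

/-- The lower section of `w` consists of two vertices or of two edges, of the given type. -/
def HasRepeatedMinimum (φ : Additive (FreeGroup α) →+ ℤ) (a b : α) (w : List (α × Bool)) : Prop :=
  (∃ p q, p ≠ q ∧ lowerVertices φ w = {p, q} ∧ lowerEdges φ w = ∅ ∧
    IsVertexOfType a b w p ∧ IsVertexOfType a b w q) ∨
  (∃ p q, p ≠ q ∧ lowerVertices φ w = {p, next w p, q, next w q} ∧ lowerEdges φ w = {p, q} ∧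
    IsEdgeOfType a b w p ∧ IsEdgeOfType a b w q)

/-- The tail of the edge `p` for the direction in which it reads the generator `x_a`
rather than `x_a⁻¹`. -/
def tail (w : List (α × Bool)) (p : Fin w.length) : Fin w.length :=
  if (w.get p).2 = true then p else next w p

/-- Two minima of `w` of opposite orientation are never joined by a path whose label is trivial
in `G` (the quotient of the free group by `π`). Two minimal vertices have opposite orientation if
one is entered by the generator by which the other is left, and vice versa; two minimal edges with
the same generator have opposite orientation if one is labelled `x_a` and the other `x_a⁻¹`,
and in this case the path joins their tails. -/
def OppositeMinimaDistinct {G : Type*} [Group G] (π : FreeGroup α →* G)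
    (φ : Additive (FreeGroup α) →+ ℤ) (w : List (α × Bool)) : Prop :=
  (lowerEdges φ w = ∅ → ∀ p ∈ lowerVertices φ w, ∀ q ∈ lowerVertices φ w, p ≠ q →
    (w.get (prev w p)).1 = (w.get q).1 → (w.get p).1 = (w.get (prev w q)).1 →
    π (label w p) ≠ π (label w q)) ∧
  (∀ p ∈ lowerEdges φ w, ∀ q ∈ lowerEdges φ w,
    (w.get p).1 = (w.get q).1 → (w.get p).2 ≠ (w.get q).2 →
    π (label w (tail w p)) ≠ π (label w (tail w q)))

end CyclicWord

open CyclicWord in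
/-- The unique minimum condition for `n` words in `x_1, …, x_{n+1}`; the permutations `ρ` and `σ`
are the re-ordering of the generators and of the relators. -/
def UniqueMinimumCondition {n : ℕ} (r : Fin n → List (Fin (n + 1) × Bool))
    (φ : Additive (FreeGroup (Fin (n + 1))) →+ ℤ) : Prop :=
  (∀ i, FreeGroup.IsCyclicallyReduced (r i)) ∧
  ∃ (ρ : Equiv.Perm (Fin (n + 1))) (σ : Equiv.Perm (Fin n)),
    (∀ i : Fin n, 0 ≤ φ (Additive.ofMul (FreeGroup.of (ρ i.castSucc)))) ∧
    φ (Additive.ofMul (FreeGroup.of (ρ (Fin.last n)))) < 0 ∧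
    (∀ i, φ (Additive.ofMul (FreeGroup.mk (r i))) = 0) ∧
    ∀ i : Fin n, HasUniqueMinimum φ (ρ i.castSucc) (ρ (Fin.last n)) (r (σ i))

open CyclicWord in
/-- The repeated minimum condition: as the unique minimum condition, except that at exactly one
relator the lower section consists of two vertices or two edges of the required type. -/
def RepeatedMinimumCondition {n : ℕ} (r : Fin n → List (Fin (n + 1) × Bool))
    (φ : Additive (FreeGroup (Fin (n + 1))) →+ ℤ) : Prop :=
  (∀ i, FreeGroup.IsCyclicallyReduced (r i)) ∧
  ∃ (ρ : Equiv.Perm (Fin (n + 1))) (σ : Equiv.Perm (Fin n)),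
    (∀ i : Fin n, 0 ≤ φ (Additive.ofMul (FreeGroup.of (ρ i.castSucc)))) ∧
    φ (Additive.ofMul (FreeGroup.of (ρ (Fin.last n)))) < 0 ∧
    (∀ i, φ (Additive.ofMul (FreeGroup.mk (r i))) = 0) ∧
    ∃ j : Fin n,
      HasRepeatedMinimum φ (ρ j.castSucc) (ρ (Fin.last n)) (r (σ j)) ∧
      ∀ i : Fin n, i ≠ j → HasUniqueMinimum φ (ρ i.castSucc) (ρ (Fin.last n)) (r (σ i))

/-- The set of relators, as elements of the free group. -/
def relatorSet {n : ℕ} (r : Fin n → List (Fin (n + 1) × Bool)) :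
    Set (FreeGroup (Fin (n + 1))) :=
  Set.range fun i => FreeGroup.mk (r i)

/-- The group `⟨x_1, …, x_{n+1} | r_1, …, r_n⟩`. -/
abbrev DeficiencyOneGroup {n : ℕ} (r : Fin n → List (Fin (n + 1) × Bool)) : Type :=
  PresentedGroup (relatorSet r)

/-- The homomorphism `F(x_1, …, x_{n+1}) → ℤ` induced by a homomorphism `G → ℤ`. -/
def liftToFree {n : ℕ} {r : Fin n → List (Fin (n + 1) × Bool)}
    (φ : Additive (DeficiencyOneGroup r) →+ ℤ) : Additive (FreeGroup (Fin (n + 1))) →+ ℤ :=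
  φ.comp (MonoidHom.toAdditive (PresentedGroup.mk (relatorSet r)))

/-! Write `b` for the generator of negative height and `a` for any other.

Unique minima. Around a translate of the relator attached to `a`, the minimum lies between an
`a`-edge and a `b`-edge, or is an `a`-edge between two `b`-edges; the rest of the loop runs strictly
higher. That rest gives a path from `b⁻¹` to `a b⁻¹` in heights at least 1
(`HasUniqueMinimum.pathAbove`). Hence right multiplication by `b⁻¹` pushes every edge, and so every
path, up by one level, and a path between vertices of non-negative height can be pushed up until it
stays in non-negative heights (`pathAbove_zero`).

Repeated minimum. Suppose the upper half of the Cayley graph is connected. Conjugating by a high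
power of `b` then gives, for each `a`, a relation whose Fox derivatives, apart from column `b`, are
`-e_a` up to terms of positive height (`exists_relation_fox`). These derivatives are a left
combination of the rows of the Fox matrix (`fox_mem_span`). After translating its rows, the square
matrix without column `b` has a diagonal lowest part: the entry is `±1` at a unique minimum and `±1
± g` at the repeated one, where the condition on opposite orientation keeps it non-zero. In the
absence of zero-divisors no coefficient of the combination can reach below height 0, so comparing
height 0 in the exceptional column gives `y * d = -1` with `d = ±1 ± g`. The augmentation of `d` is
even, a contradiction (`false_of_lowest_part_even`). -/

/-- The value at `g` of a homomorphism from `G` to the integers. -/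
def height {G : Type*} [Group G] (χ : Additive G →+ ℤ) (g : G) : ℤ := χ (Additive.ofMul g)

section Height

variable {G : Type*} [Group G] (χ : Additive G →+ ℤ)

@[simp] lemma height_one : height χ (1 : G) = 0 := by simp [height]

@[simp] lemma height_mul (g h : G) : height χ (g * h) = height χ g + height χ h := by
  simp [height]

@[simp] lemma height_inv (g : G) : height χ g⁻¹ = -height χ g := by simp [height]

@[simp] lemma height_neg (g : G) : height (-χ) g = -height χ g := rfl

@[simp] lemma height_pow (g : G) (k : ℕ) : height χ (g ^ k) = k * height χ g := by
  simp [height]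

end Height

/-! ### Relator loops in the Cayley graph and the edges at their minima -/

namespace CyclicWord

variable {α : Type*} {G : Type*} [Group G] (π : FreeGroup α →* G) (χ : Additive G →+ ℤ)
  (w : List (α × Bool))

@[simp] lemma next_prev (p : Fin w.length) : next w (prev w p) = p :=
  (finRotate w.length).apply_symm_apply p

@[simp] lemma prev_next (p : Fin w.length) : prev w (next w p) = p :=
  (finRotate w.length).symm_apply_apply p

lemma val_next (p : Fin w.length) :
    (next w p : ℕ) = if (p : ℕ) + 1 = w.length then 0 else (p : ℕ) + 1 := by
  unfold next
  generalize w.length = N at p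
  cases N with
  | zero => exact p.elim0
  | succ m =>
    rw [coe_finRotate]
    simp [Fin.ext_iff]

/-- The vertex of the Cayley graph over which the vertex `p` of `C_w` lies. -/
def vertex (p : Fin w.length) : G := π (label w p)

/-- Triviality of `w` in `G` matters only at the last edge, which returns to the marked vertex: it
makes the loop close up. -/
lemma vertex_next {w : List (α × Bool)} (hw : π (FreeGroup.mk w) = 1) (p : Fin w.length) :
    vertex π w (next w p) = vertex π w p * π (FreeGroup.mk [w.get p]) := by
  have key : vertex π w p * π (FreeGroup.mk [w.get p]) =
      π (FreeGroup.mk (w.take (p + 1))) := by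
    rw [vertex, label, ← map_mul, FreeGroup.mul_mk]
    simp
  rw [key, vertex, label, val_next]
  split_ifs with h
  · rw [h, List.take_length, hw, List.take_zero, ← FreeGroup.one_eq_mk, map_one]
  · rfl

lemma map_mk_singleton (l : α × Bool) :
    π (FreeGroup.mk [l]) =
      if l.2 = true then π (FreeGroup.of l.1) else (π (FreeGroup.of l.1))⁻¹ := by
  obtain ⟨a, b⟩ := l
  cases b
  · simp only [Bool.false_eq_true, if_false, ← map_inv]
    rfl
  · rfl

variable {π χ w}

lemma vertex_next_of_pos (hw : π (FreeGroup.mk w) = 1) {p : Fin w.length}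
    (hp : (w.get p).2 = true) :
    vertex π w (next w p) = vertex π w p * π (FreeGroup.of (w.get p).1) := by
  rw [vertex_next π hw, map_mk_singleton, if_pos hp]

lemma vertex_next_of_neg (hw : π (FreeGroup.mk w) = 1) {p : Fin w.length}
    (hp : (w.get p).2 = false) :
    vertex π w (next w p) = vertex π w p * (π (FreeGroup.of (w.get p).1))⁻¹ := by
  rw [vertex_next π hw, map_mk_singleton, if_neg (by rw [hp]; exact Bool.false_ne_true)]

lemma mem_lowerVertices {p : Fin w.length} :
    p ∈ lowerVertices (χ.comp (MonoidHom.toAdditive π)) w ↔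
      ∀ q, height χ (vertex π w p) ≤ height χ (vertex π w q) := Iff.rfl

lemma mem_lowerVertices_of_le {p q : Fin w.length}
    (hp : p ∈ lowerVertices (χ.comp (MonoidHom.toAdditive π)) w)
    (h : height χ (vertex π w q) ≤ height χ (vertex π w p)) :
    q ∈ lowerVertices (χ.comp (MonoidHom.toAdditive π)) w :=
  mem_lowerVertices.2 fun s => h.trans (mem_lowerVertices.1 hp s)

lemma lt_of_notMem_lowerVertices {p q : Fin w.length}
    (hp : p ∈ lowerVertices (χ.comp (MonoidHom.toAdditive π)) w)
    (hq : q ∉ lowerVertices (χ.comp (MonoidHom.toAdditive π)) w) :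
    height χ (vertex π w p) < height χ (vertex π w q) := by
  by_contra h
  exact hq (mem_lowerVertices_of_le hp (not_lt.1 h))

lemma tail_of_pos {p : Fin w.length} (hp : (w.get p).2 = true) : tail w p = p := if_pos hp

lemma tail_of_neg {p : Fin w.length} (hp : (w.get p).2 = false) : tail w p = next w p :=
  if_neg (by rw [hp]; exact Bool.false_ne_true)

lemma eq_or_eq_prev_of_tail_eq {p v : Fin w.length} (h : tail w p = v) :
    p = v ∨ p = prev w v := by
  cases hp : (w.get p).2
  · rw [tail_of_neg hp] at h
    right
    rw [← h, prev_next]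
  · rw [tail_of_pos hp] at h
    exact .inl h

lemma tail_mem_lowerVertices {φ : Additive (FreeGroup α) →+ ℤ} {p : Fin w.length}
    (hp : p ∈ lowerEdges φ w) : tail w p ∈ lowerVertices φ w := by
  cases h : (w.get p).2
  · rw [tail_of_neg h]; exact hp.2
  · rw [tail_of_pos h]; exact hp.1

/-- At an isolated minimal vertex of type `(a, b)` exactly one edge not labelled `b^±` has its
tail; it is labelled `a^±`. -/
lemma exists_edge_of_isVertexOfType {a b : α} {v : Fin w.length} (hw : π (FreeGroup.mk w) = 1)
    (ha : 0 ≤ height χ (π (FreeGroup.of a)))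
    (hv : v ∈ lowerVertices (χ.comp (MonoidHom.toAdditive π)) w)
    (he : lowerEdges (χ.comp (MonoidHom.toAdditive π)) w = ∅) (ht : IsVertexOfType a b w v) :
    ∃ p, (w.get p).1 = a ∧
      (((w.get p).2 = true ∧ (w.get v).1 = a ∧ (w.get (prev w v)).1 = b) ∨
        ((w.get p).2 = false ∧ (w.get (prev w v)).1 = a ∧ (w.get v).1 = b)) ∧
      ∀ q, (w.get q).1 ≠ b → (tail w q = v ↔ q = p) := by
  have he' : ∀ p, p ∉ lowerEdges (χ.comp (MonoidHom.toAdditive π)) w := by simp [he]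
  rcases ht.symm with ⟨h1, h2⟩ | ⟨h1, h2⟩
  -- Leaving `v` by `a⁻¹` would not raise the height, so the edge `v` would belong to the lower
  -- section. The next bullet is the mirror image.
  · have hpos : (w.get v).2 = true := by
      by_contra h
      have h := vertex_next_of_neg hw (Bool.eq_false_iff.2 h)
      refine he' v ⟨hv, mem_lowerVertices_of_le hv ?_⟩
      rw [h, h2, height_mul, height_inv]
      lia
    refine ⟨v, h2, .inl ⟨hpos, h2, h1⟩, fun q hq => ⟨fun h => ?_, fun h => ?_⟩⟩
    · rcases eq_or_eq_prev_of_tail_eq h with h | h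
      · exact h
      · exact absurd h1 (h ▸ hq)
    · rw [h, tail_of_pos hpos]
  · have hneg : (w.get (prev w v)).2 = false := by
      by_contra h
      have h := vertex_next_of_pos hw (Bool.eq_true_of_not_eq_false h)
      rw [next_prev, h1] at h
      refine he' (prev w v) ⟨mem_lowerVertices_of_le hv ?_, by rwa [next_prev]⟩
      rw [h, height_mul]
      lia
    refine ⟨prev w v, h1, .inr ⟨hneg, h1, h2⟩, fun q hq => ⟨fun h => ?_, fun h => ?_⟩⟩
    · rcases eq_or_eq_prev_of_tail_eq h with h | h
      · exact absurd h2 (h ▸ hq)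
      · exact h
    · rw [h, tail_of_neg hneg, next_prev]

/-- Only `e` and its two neighbours touch an endpoint of `e`, and the neighbours are labelled by
`b`. -/
lemma eq_of_tail_mem_of_isEdgeOfType {a b : α} {e q : Fin w.length} (ht : IsEdgeOfType a b w e)
    (hq : (w.get q).1 ≠ b) (h : tail w q = e ∨ tail w q = next w e) : q = e := by
  obtain ⟨-, h2, h3⟩ := ht
  rcases h with h | h <;> rcases eq_or_eq_prev_of_tail_eq h with h | h
  · exact h
  · exact absurd h2 (h ▸ hq)
  · exact absurd h3 (h ▸ hq)
  · rw [h, prev_next]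

/-- If the minimum is unique, exactly one edge not labelled `b^±` has a minimal tail. -/
lemma HasUniqueMinimum.exists_edge {a b : α} (hw : π (FreeGroup.mk w) = 1)
    (ha : 0 ≤ height χ (π (FreeGroup.of a)))
    (h : HasUniqueMinimum (χ.comp (MonoidHom.toAdditive π)) a b w) :
    ∃ p, (w.get p).1 = a ∧ ∀ q, (w.get q).1 ≠ b →
      (tail w q ∈ lowerVertices (χ.comp (MonoidHom.toAdditive π)) w ↔ q = p) := by
  rcases h with ⟨v, hv, he, ht⟩ | ⟨e, hv, he, ht⟩
  · obtain ⟨p, hp, -, h⟩ := exists_edge_of_isVertexOfType hw ha (by simp [hv]) he ht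
    exact ⟨p, hp, by simpa [hv] using h⟩
  · refine ⟨e, ht.1, fun q hq => ⟨fun h => ?_, fun h => ?_⟩⟩
    · exact eq_of_tail_mem_of_isEdgeOfType ht hq (by simpa [hv] using h)
    · exact tail_mem_lowerVertices (by simp [he, h])

/-- If the minimum is repeated, exactly two edges not labelled `b^±` have a minimal tail. -/
lemma HasRepeatedMinimum.exists_edges {a b : α} (hw : π (FreeGroup.mk w) = 1)
    (hab : a ≠ b) (ha : 0 ≤ height χ (π (FreeGroup.of a)))
    (h : HasRepeatedMinimum (χ.comp (MonoidHom.toAdditive π)) a b w)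
    (hopp : OppositeMinimaDistinct π (χ.comp (MonoidHom.toAdditive π)) w) :
    ∃ p q, p ≠ q ∧ (w.get p).1 = a ∧ (w.get q).1 = a ∧
      (∀ s, (w.get s).1 ≠ b →
        (tail w s ∈ lowerVertices (χ.comp (MonoidHom.toAdditive π)) w ↔ s = p ∨ s = q)) ∧
      ((w.get p).2 ≠ (w.get q).2 → vertex π w (tail w p) ≠ vertex π w (tail w q)) := by
  rcases h with ⟨v, v', hne, hv, he, ht, ht'⟩ | ⟨e, e', hne, hv, he, ht, ht'⟩
  · have hvm : v ∈ lowerVertices (χ.comp (MonoidHom.toAdditive π)) w := by simp [hv]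
    have hvm' : v' ∈ lowerVertices (χ.comp (MonoidHom.toAdditive π)) w := by simp [hv]
    obtain ⟨p, hp, ho, h⟩ := exists_edge_of_isVertexOfType hw ha hvm he ht
    obtain ⟨p', hp', ho', h'⟩ := exists_edge_of_isVertexOfType hw ha hvm' he ht'
    have htp : tail w p = v := (h p (by rwa [hp])).2 rfl
    have htp' : tail w p' = v' := (h' p' (by rwa [hp'])).2 rfl
    refine ⟨p, p', fun hpp => hne (by rw [← htp, hpp, htp']), hp, hp', fun s hs => ?_, fun hs => ?_⟩
    · rw [hv, ← h s hs, ← h' s hs]; rfl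
    · rw [htp, htp']
      have := hopp.1 he v hvm v' hvm' hne
      -- The exponent of the `a`-edge at a minimal vertex records whether it follows or precedes the
      -- vertex, so different exponents mean opposite orientation.
      rcases ho with ⟨o1, o2, o3⟩ | ⟨o1, o2, o3⟩ <;> rcases ho' with ⟨o1', o2', o3'⟩ | ⟨o1', o2', o3'⟩
      · exact absurd (o1.trans o1'.symm) hs
      · exact this (by rw [o3, o3']) (by rw [o2, o2'])
      · exact this (by rw [o2, o2']) (by rw [o3, o3'])
      · exact absurd (o1.trans o1'.symm) hs
  · refine ⟨e, e', hne, ht.1, ht'.1, fun s hs => ⟨fun h => ?_, fun h => ?_⟩, ?_⟩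
    · simp only [hv, Set.mem_insert_iff, Set.mem_singleton_iff] at h
      rcases h with h | h | h | h
      · exact .inl (eq_of_tail_mem_of_isEdgeOfType ht hs (.inl h))
      · exact .inl (eq_of_tail_mem_of_isEdgeOfType ht hs (.inr h))
      · exact .inr (eq_of_tail_mem_of_isEdgeOfType ht' hs (.inl h))
      · exact .inr (eq_of_tail_mem_of_isEdgeOfType ht' hs (.inr h))
    · exact tail_mem_lowerVertices (by simpa [he] using h)
    · exact hopp.2 e (by simp [he]) e' (by simp [he]) (by rw [ht.1, ht'.1])

end CyclicWord

open Relation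

/-! ### Pushing paths upwards in the Cayley graph -/

section Paths

variable {α : Type*} {G : Type*} [Group G] (π : FreeGroup α →* G) (χ : Additive G →+ ℤ)

/-- `g` and `h` are joined by an edge of the Cayley graph with respect to the images of the free
generators, and both have height at least `m`. -/
def StepAbove (m : ℤ) (g h : G) : Prop :=
  m ≤ height χ g ∧ m ≤ height χ h ∧
    ∃ a, h = g * π (FreeGroup.of a) ∨ g = h * π (FreeGroup.of a)

/-- `g` and `h` are joined by a path of the Cayley graph in heights at least `m`. -/
def PathAbove (m : ℤ) : G → G → Prop := ReflTransGen (StepAbove π χ m)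

variable {π χ}

lemma StepAbove.symm {m : ℤ} {g h : G} (H : StepAbove π χ m g h) : StepAbove π χ m h g :=
  ⟨H.2.1, H.1, H.2.2.imp fun _ => Or.symm⟩

lemma PathAbove.symm {m : ℤ} {g h : G} (H : PathAbove π χ m g h) : PathAbove π χ m h g :=
  have : Std.Symm (StepAbove π χ m) := ⟨fun _ _ => StepAbove.symm⟩
  ReflTransGen.stdSymm.symm _ _ H

lemma PathAbove.mono {m m' : ℤ} (hm : m' ≤ m) {g h : G} (H : PathAbove π χ m g h) :
    PathAbove π χ m' g h :=
  ReflTransGen.mono (fun _ _ H => ⟨hm.trans H.1, hm.trans H.2.1, H.2.2⟩) _ _ H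

lemma PathAbove.mul_left {m : ℤ} {g h : G} (k : G) (H : PathAbove π χ m g h) :
    PathAbove π χ (height χ k + m) (k * g) (k * h) := by
  refine ReflTransGen.lift (k * ·) (fun g h H => ?_) _ _ H
  obtain ⟨h1, h2, a, h3⟩ := H
  refine ⟨by rw [height_mul]; lia, by rw [height_mul]; lia, a, ?_⟩
  rcases h3 with rfl | rfl
  · exact .inl (mul_assoc ..).symm
  · exact .inr (mul_assoc ..).symm

/-- A word visits finitely many vertices. The bound is the negative of a natural number so that
`pathAbove_zero` can climb by induction on it. -/
lemma exists_pathAbove (g : G) (f : FreeGroup α) : ∃ k : ℕ, PathAbove π χ (-k) g (g * π f) := by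
  have step (g : G) (a : α) : ∃ k : ℕ, PathAbove π χ (-k) g (g * π (FreeGroup.of a)) := by
    refine ⟨(height χ g).natAbs + (height χ (g * π (FreeGroup.of a))).natAbs, .single
      ⟨by lia, by lia, a, .inl rfl⟩⟩
  induction f using FreeGroup.induction_on generalizing g with
  | C1 => exact ⟨0, by rw [map_one, mul_one]; exact .refl⟩
  | of a => exact step g a
  | inv_of a _ =>
    obtain ⟨k, hk⟩ := step (g * π (FreeGroup.of a)⁻¹) a
    refine ⟨k, ?_⟩
    rw [map_inv, inv_mul_cancel_right] at hk
    rw [map_inv]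
    exact hk.symm
  | mul f f' ih ih' =>
    obtain ⟨k, hk⟩ := ih g
    obtain ⟨k', hk'⟩ := ih' (g * π f)
    refine ⟨max k k', ?_⟩
    rw [map_mul, ← mul_assoc]
    exact (hk.mono (by lia)).trans (hk'.mono (by lia))

/-- A `b`-edge moves to the `b`-edge just before it, which is higher because `b` descends. An
`a`-edge starting at `g` is replaced by the `g`-translate of the path in `hgen`, whose heights are
at least `height χ g + 1`. -/
lemma StepAbove.pathAbove_mul_right {b : α} (hb : height χ (π (FreeGroup.of b)) < 0)
    (hgen : ∀ a, a ≠ b → PathAbove π χ 1 (π (FreeGroup.of b))⁻¹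
      (π (FreeGroup.of a) * (π (FreeGroup.of b))⁻¹)) {m : ℤ} {g h : G}
    (H : StepAbove π χ m g h) :
    PathAbove π χ (m + 1) (g * (π (FreeGroup.of b))⁻¹) (h * (π (FreeGroup.of b))⁻¹) := by
  have aux {g : G} (a : α) (hg : m ≤ height χ g) (hga : m ≤ height χ (g * π (FreeGroup.of a))) :
      PathAbove π χ (m + 1) (g * (π (FreeGroup.of b))⁻¹)
        (g * π (FreeGroup.of a) * (π (FreeGroup.of b))⁻¹) := by
    by_cases hab : a = b
    · subst hab
      rw [mul_inv_cancel_right]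
      rw [height_mul] at hga
      refine .single ⟨?_, by lia, a, .inl (inv_mul_cancel_right _ _).symm⟩
      rw [height_mul, height_inv]
      lia
    · rw [mul_assoc]
      exact ((hgen a hab).mul_left g).mono (by lia)
  obtain ⟨h1, h2, a, rfl | rfl⟩ := H
  · exact aux a h1 h2
  · exact (aux a h2 h1).symm

/-- If every edge of the Cayley graph can be pushed up by right multiplication by the inverse of
the image of `b`, then any two vertices of non-negative height are joined in non-negative
heights. -/
lemma pathAbove_zero (hπ : Function.Surjective π) {b : α}
    (hb : height χ (π (FreeGroup.of b)) < 0)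
    (hgen : ∀ a, a ≠ b → PathAbove π χ 1 (π (FreeGroup.of b))⁻¹
      (π (FreeGroup.of a) * (π (FreeGroup.of b))⁻¹))
    {g h : G} (hg : 0 ≤ height χ g) (hh : 0 ≤ height χ h) : PathAbove π χ 0 g h := by
  have step {m : ℤ} {g : G} (hg : m ≤ height χ g) :
      PathAbove π χ m g (g * (π (FreeGroup.of b))⁻¹) := by
    refine .single ⟨hg, ?_, b, .inr (inv_mul_cancel_right _ _).symm⟩
    rw [height_mul, height_inv]
    lia
  -- The new path is `g → g b⁻¹ ⇝ h b⁻¹ → h`; its first and last edges lie in non-negative heights,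
  -- hence above `m + 1` as long as `m + 1 ≤ 0`.
  have push (m : ℤ) (H : PathAbove π χ m g h) (hm : m + 1 ≤ 0) : PathAbove π χ (m + 1) g h := by
    have H' : PathAbove π χ (m + 1) (g * (π (FreeGroup.of b))⁻¹)
        (h * (π (FreeGroup.of b))⁻¹) := by
      clear hh
      induction H with
      | refl => exact .refl
      | tail _ H ih => exact ih.trans (H.pathAbove_mul_right hb hgen)
    exact ((step (by lia)).trans H').trans (step (by lia)).symm
  obtain ⟨f, hf⟩ := hπ (g⁻¹ * h)
  obtain ⟨k, hk⟩ := exists_pathAbove (π := π) (χ := χ) g f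
  rw [hf, mul_inv_cancel_left] at hk
  induction k with
  | zero => simpa using hk
  | succ k ih =>
    refine ih ?_
    have := push _ hk (by push_cast; lia)
    rwa [Nat.cast_succ, neg_add, neg_add_cancel_right] at this

lemma connected_mulCayley (h : ∀ g h, 0 ≤ height χ g → 0 ≤ height χ h → PathAbove π χ 0 g h) :
    ((SimpleGraph.mulCayley (Set.range fun a => π (FreeGroup.of a))).induce
      {g : G | 0 ≤ height χ g}).Connected := by
  have reach (g k : G) (hg : 0 ≤ height χ g) (H : PathAbove π χ 0 g k) (hk : 0 ≤ height χ k) :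
      ((SimpleGraph.mulCayley (Set.range fun a => π (FreeGroup.of a))).induce
        {g : G | 0 ≤ height χ g}).Reachable ⟨g, hg⟩ ⟨k, hk⟩ := by
    induction H with
    | refl => exact .refl _
    | @tail b c _ H ih =>
      refine (ih H.1).trans ?_
      -- A generator that is trivial in `G` gives a constant step, whereas a simple graph has no
      -- loops.
      by_cases hbc : b = c
      · subst hbc; exact .refl _
      · refine SimpleGraph.Adj.reachable ?_
        obtain ⟨-, -, a, ha⟩ := H
        rw [SimpleGraph.comap_adj, SimpleGraph.mulCayley_adj']
        exact ⟨hbc, _, ⟨a, rfl⟩, ha.imp Eq.symm id⟩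
  have : Nonempty {g : G | 0 ≤ height χ g} := ⟨1, (height_one χ).ge⟩
  exact ⟨fun g k => reach g k g.2 (h g k g.2 k.2) k.2⟩

end Paths

/-! ### Relators with a unique minimum push edges upwards -/

namespace CyclicWord

variable {α : Type*} {G : Type*} [Group G] {π : FreeGroup α →* G} {χ : Additive G →+ ℤ}
  {w : List (α × Bool)}

/-- Starting in a set of vertices of `C_w` and going clockwise, one stays in the set until one
leaves it. -/
lemma exists_reflTransGen_prev {w : List (α × Bool)} (H : Set (Fin w.length)) (k : ℕ)
    (x : Fin w.length) (hx : x ∈ H) (hk : (next w)^[k] x ∉ H) :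
    ∃ y ∉ H, prev w y ∈ H ∧
      ReflTransGen (fun p q => p ∈ H ∧ q ∈ H ∧ next w p = q) x (prev w y) := by
  induction k generalizing x with
  | zero => exact absurd hx hk
  | succ k ih =>
    by_cases h : next w x ∈ H
    · obtain ⟨y, hy, hy', hr⟩ := ih _ h hk
      exact ⟨y, hy, hy', .head ⟨hx, h, rfl⟩ hr⟩
    · exact ⟨next w x, h, by rwa [prev_next], by rw [prev_next]⟩

lemma exists_iterate_next (w : List (α × Bool)) (p : Fin w.length) (j : ℕ) :
    ∃ k, (next w)^[k] ((next w)^[j] p) = p := by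
  have h : (next w)^[orderOf (finRotate w.length)] = id := by
    change (finRotate w.length)^[_] = id
    rw [← Equiv.Perm.coe_pow, pow_orderOf_eq_one, Equiv.Perm.coe_one]
  have hpos : 0 < orderOf (finRotate w.length) := orderOf_pos _
  -- With the `j` steps already made this completes `j` periods of the rotation.
  refine ⟨orderOf (finRotate w.length) * j - j, ?_⟩
  rw [← Function.iterate_add_apply, Nat.sub_add_cancel (Nat.le_mul_of_pos_left _ hpos),
    Function.iterate_mul, h, Function.iterate_id, id]

lemma stepAbove_next (hw : π (FreeGroup.mk w) = 1) {m : ℤ} {p : Fin w.length}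
    (h : m ≤ height χ (vertex π w p)) (h' : m ≤ height χ (vertex π w (next w p))) :
    StepAbove π χ m (vertex π w p) (vertex π w (next w p)) := by
  refine ⟨h, h', (w.get p).1, ?_⟩
  cases hp : (w.get p).2
  · exact .inr (by rw [vertex_next_of_neg hw hp, inv_mul_cancel_right])
  · exact .inl (vertex_next_of_pos hw hp)

/-- The part of `C_w` between two consecutive minimal vertices is a path above the minimum. -/
lemma exists_pathAbove_prev (hw : π (FreeGroup.mk w) = 1) {v x : Fin w.length} {j : ℕ}
    (hv : v ∈ lowerVertices (χ.comp (MonoidHom.toAdditive π)) w) (hj : (next w)^[j] v = x)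
    (hx : x ∉ lowerVertices (χ.comp (MonoidHom.toAdditive π)) w) :
    ∃ y ∈ lowerVertices (χ.comp (MonoidHom.toAdditive π)) w,
      prev w y ∉ lowerVertices (χ.comp (MonoidHom.toAdditive π)) w ∧
      PathAbove π χ (height χ (vertex π w v) + 1) (vertex π w x) (vertex π w (prev w y)) := by
  obtain ⟨k, hk⟩ := exists_iterate_next w v j
  rw [hj] at hk
  obtain ⟨y, hy, hy', hr⟩ := exists_reflTransGen_prev
    (lowerVertices (χ.comp (MonoidHom.toAdditive π)) w)ᶜ k x hx (by rw [hk]; exact not_not.2 hv)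
  refine ⟨y, not_not.1 hy, hy', ReflTransGen.lift (vertex π w) (fun p q H => ?_) _ _ hr⟩
  obtain ⟨hp, hq, rfl⟩ := H
  exact stepAbove_next hw (lt_of_notMem_lowerVertices hv hp) (lt_of_notMem_lowerVertices hv hq)

/-- Here and in the next three lemmas, the heights of the endpoints of an edge determine the
exponent of its letter: away from a minimum one leaves by the inverse of a descending generator, or
by a non-descending generator itself. -/
lemma vertex_next_of_neg_height (hw : π (FreeGroup.mk w) = 1) {p : Fin w.length}
    (hb : height χ (π (FreeGroup.of (w.get p).1)) < 0)
    (h : height χ (vertex π w p) ≤ height χ (vertex π w (next w p))) :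
    vertex π w (next w p) = vertex π w p * (π (FreeGroup.of (w.get p).1))⁻¹ := by
  cases hp : (w.get p).2
  · exact vertex_next_of_neg hw hp
  · rw [vertex_next_of_pos hw hp, height_mul] at h
    lia

lemma vertex_eq_of_neg_height (hw : π (FreeGroup.mk w) = 1) {p : Fin w.length}
    (hb : height χ (π (FreeGroup.of (w.get p).1)) < 0)
    (h : height χ (vertex π w (next w p)) ≤ height χ (vertex π w p)) :
    vertex π w p = vertex π w (next w p) * (π (FreeGroup.of (w.get p).1))⁻¹ := by
  cases hp : (w.get p).2
  · rw [vertex_next_of_neg hw hp, height_mul, height_inv] at h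
    lia
  · rw [vertex_next_of_pos hw hp, mul_inv_cancel_right]

lemma vertex_next_of_pos_height (hw : π (FreeGroup.mk w) = 1) {p : Fin w.length}
    (hb : 0 ≤ height χ (π (FreeGroup.of (w.get p).1)))
    (h : height χ (vertex π w p) < height χ (vertex π w (next w p))) :
    vertex π w (next w p) = vertex π w p * π (FreeGroup.of (w.get p).1) := by
  cases hp : (w.get p).2
  · rw [vertex_next_of_neg hw hp, height_mul, height_inv] at h
    lia
  · exact vertex_next_of_pos hw hp

lemma vertex_eq_of_pos_height (hw : π (FreeGroup.mk w) = 1) {p : Fin w.length}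
    (hb : 0 ≤ height χ (π (FreeGroup.of (w.get p).1)))
    (h : height χ (vertex π w (next w p)) < height χ (vertex π w p)) :
    vertex π w p = vertex π w (next w p) * π (FreeGroup.of (w.get p).1) := by
  cases hp : (w.get p).2
  · rw [vertex_next_of_neg hw hp, inv_mul_cancel_right]
  · rw [vertex_next_of_pos hw hp, height_mul] at h
    lia

/-- A relator with a unique minimum pushes the edges labelled `a` up by the inverse of `b`. -/
lemma HasUniqueMinimum.pathAbove {a b : α} (hw : π (FreeGroup.mk w) = 1) (hab : a ≠ b)
    (ha : 0 ≤ height χ (π (FreeGroup.of a))) (hb : height χ (π (FreeGroup.of b)) < 0)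
    (h : HasUniqueMinimum (χ.comp (MonoidHom.toAdditive π)) a b w) :
    PathAbove π χ 1 (π (FreeGroup.of b))⁻¹
      (π (FreeGroup.of a) * (π (FreeGroup.of b))⁻¹) := by
  rcases h with ⟨v, hv, he, ht⟩ | ⟨e, hv, he, ht⟩
  · have hvm : v ∈ lowerVertices (χ.comp (MonoidHom.toAdditive π)) w := by simp [hv]
    have he' : ∀ p, p ∉ lowerEdges (χ.comp (MonoidHom.toAdditive π)) w := by simp [he]
    have hnx : next w v ∉ lowerVertices (χ.comp (MonoidHom.toAdditive π)) w :=
      fun h => he' v ⟨hvm, h⟩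
    have hpv : prev w v ∉ lowerVertices (χ.comp (MonoidHom.toAdditive π)) w :=
      fun h => he' (prev w v) ⟨h, by rwa [next_prev]⟩
    have hnx' := lt_of_notMem_lowerVertices hvm hnx
    have hpv' : height χ (vertex π w (next w (prev w v))) < height χ (vertex π w (prev w v)) := by
      rw [next_prev]; exact lt_of_notMem_lowerVertices hvm hpv
    obtain ⟨y, hy, -, hpath⟩ := exists_pathAbove_prev (j := 1) hw hvm rfl hnx
    obtain rfl : y = v := by simpa [hv] using hy
    rw [Function.iterate_one] at hpath
    -- The two neighbours of the minimum `y` are `y b⁻¹` and `y a`, in the order given by the type,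
    -- and `a` has positive height because it leads away from an isolated minimum.
    have key : PathAbove π χ (height χ (vertex π w y) + 1)
        (vertex π w y * (π (FreeGroup.of b))⁻¹) (vertex π w y * π (FreeGroup.of a)) ∧
        0 < height χ (π (FreeGroup.of a)) := by
      rcases ht with ⟨h1, h2⟩ | ⟨h1, h2⟩
      · rw [vertex_next_of_neg_height hw (by rwa [h2]) hnx'.le, h2] at hpath
        have := vertex_eq_of_pos_height hw (by rwa [h1]) hpv'
        rw [next_prev, h1] at this
        rw [next_prev, this, height_mul] at hpv'
        rw [this] at hpath
        exact ⟨hpath, by lia⟩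
      · have h3 := vertex_next_of_pos_height hw (by rwa [h2]) hnx'
        rw [h2] at h3
        have := vertex_eq_of_neg_height hw (by rwa [h1]) hpv'.le
        rw [next_prev, h1] at this
        rw [h3, height_mul] at hnx'
        rw [h3, this] at hpath
        exact ⟨hpath.symm, by lia⟩
    have H := key.1.mul_left (vertex π w y)⁻¹
    rw [inv_mul_cancel_left, inv_mul_cancel_left, height_inv, neg_add_cancel_left] at H
    -- The loop only leads to `a`; one more `b`-edge, traversed upwards, reaches `a b⁻¹`.
    refine H.trans (.single ⟨key.2, ?_, b, .inr (by rw [inv_mul_cancel_right])⟩)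
    rw [height_mul, height_inv]
    lia
  · obtain ⟨h1, h2, h3⟩ := ht
    have hme : e ∈ lowerEdges (χ.comp (MonoidHom.toAdditive π)) w := by simp [he]
    have hne : next w e ≠ e := fun h => hab (by rw [← h1, ← h3, h])
    have hnx : next w (next w e) ∉ lowerVertices (χ.comp (MonoidHom.toAdditive π)) w := by
      intro h
      have : next w e ∈ lowerEdges (χ.comp (MonoidHom.toAdditive π)) w := ⟨hme.2, h⟩
      exact hne (by simpa [he] using this)
    obtain ⟨y, hy, hy', hpath⟩ := exists_pathAbove_prev (j := 2) hw hme.1 rfl hnx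
    -- The arc returns to the minimum at `e` and not at `next w e`, since the vertex before the
    -- latter is itself minimal.
    obtain rfl : y = e := by
      rw [hv] at hy
      rcases hy with h | h
      · exact h
      · rw [h, prev_next] at hy'
        exact absurd hme.1 hy'
    have hlevel : height χ (vertex π w (next w y)) = height χ (vertex π w y) :=
      le_antisymm (hme.2 _) (hme.1 _)
    have hN := vertex_next_of_neg_height hw (by rwa [h3]) (hme.2 (next w (next w y)))
    have hP := vertex_eq_of_neg_height hw (p := prev w y) (by rwa [h2])
      (by rw [next_prev]; exact hme.1 _)
    rw [next_prev] at hP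
    rw [Function.iterate_succ_apply, Function.iterate_one, hN, hP, h2, h3] at hpath
    -- The translation must bring the tail of the minimal edge to `1`: that is its end vertex when
    -- it reads `a⁻¹`, and its start otherwise.
    cases hs : (w.get y).2
    · have hE := vertex_next_of_neg hw hs
      have H := hpath.mul_left (vertex π w (next w y))⁻¹
      rw [inv_mul_cancel_left, height_inv, hlevel, neg_add_cancel_left, hE, h1] at H
      simpa [mul_assoc] using H
    · have hE := vertex_next_of_pos hw hs
      have H := hpath.mul_left (vertex π w y)⁻¹
      rw [inv_mul_cancel_left, height_inv, neg_add_cancel_left, hE, h1] at H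
      simpa [mul_assoc] using H.symm

end CyclicWord

/-! ### Fox calculus with values in the group ring -/

section Fox

variable {α : Type*} [DecidableEq α] {G : Type*} [Group G] (π : FreeGroup α →* G)

/-- The action of a word on vectors over the group ring for which the generator `a` acts by the
affine map `y ↦ e_a + a y`. -/
noncomputable def foxAction : FreeGroup α →* Equiv.Perm (α → MonoidAlgebra ℤ G) :=
  FreeGroup.lift fun a =>
    { toFun := fun y => Pi.single a 1 + MonoidAlgebra.of ℤ G (π (FreeGroup.of a)) • y
      invFun := fun y => MonoidAlgebra.of ℤ G (π (FreeGroup.of a))⁻¹ • (y - Pi.single a 1)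
      left_inv := fun y => by
        simp only [add_sub_cancel_left, smul_smul, ← map_mul, inv_mul_cancel, map_one, one_smul]
      right_inv := fun y => by
        simp only [smul_smul, ← map_mul, mul_inv_cancel, map_one, one_smul, add_sub_cancel] }

/-- The Fox derivatives of a word, with values in the group ring of `G`. -/
noncomputable def fox (f : FreeGroup α) : α → MonoidAlgebra ℤ G := foxAction π f 0

lemma foxAction_of (a : α) (y : α → MonoidAlgebra ℤ G) :
    foxAction π (FreeGroup.of a) y =
      Pi.single a 1 + MonoidAlgebra.of ℤ G (π (FreeGroup.of a)) • y := by
  rw [foxAction, FreeGroup.lift_apply_of]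
  rfl

lemma foxAction_of_inv (a : α) (y : α → MonoidAlgebra ℤ G) :
    foxAction π (FreeGroup.of a)⁻¹ y =
      MonoidAlgebra.of ℤ G (π (FreeGroup.of a))⁻¹ • (y - Pi.single a 1) := by
  rw [map_inv, foxAction, FreeGroup.lift_apply_of]
  rfl

/-- Each word acts affinely, with linear part `π f` and translation part `fox π f`; composition of
affine maps is the Fox product rule. -/
lemma foxAction_apply (f : FreeGroup α) (y : α → MonoidAlgebra ℤ G) :
    foxAction π f y = fox π f + MonoidAlgebra.of ℤ G (π f) • y := by
  rw [fox]
  induction f using FreeGroup.induction_on generalizing y with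
  | C1 => rw [map_one, map_one, map_one, one_smul, Equiv.Perm.one_apply, Equiv.Perm.one_apply,
      zero_add]
  | of a => rw [foxAction_of, foxAction_of, smul_zero, add_zero]
  | inv_of a _ =>
    rw [foxAction_of_inv, foxAction_of_inv, map_inv π, zero_sub, smul_neg, smul_sub]
    exact (neg_add_eq_sub _ _).symm
  | mul f g ihf ihg =>
    rw [map_mul, Equiv.Perm.mul_apply, Equiv.Perm.mul_apply, ihf, ihg, ihf (foxAction π g 0),
      map_mul π, map_mul (MonoidAlgebra.of ℤ G), smul_add, smul_smul, add_assoc]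

@[simp] lemma fox_one : fox π 1 = 0 := by simp [fox]

lemma fox_of (a : α) : fox π (FreeGroup.of a) = Pi.single a 1 := by
  rw [fox, foxAction_of, smul_zero, add_zero]

lemma fox_of_inv (a : α) : fox π (FreeGroup.of a)⁻¹ =
    -(MonoidAlgebra.of ℤ G (π (FreeGroup.of a))⁻¹ • Pi.single a 1) := by
  rw [fox, foxAction_of_inv, zero_sub, smul_neg]

lemma fox_mul (f g : FreeGroup α) :
    fox π (f * g) = fox π f + MonoidAlgebra.of ℤ G (π f) • fox π g := by
  rw [fox, map_mul, Equiv.Perm.mul_apply, foxAction_apply]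
  rfl

lemma fox_inv (f : FreeGroup α) :
    fox π f⁻¹ = -(MonoidAlgebra.of ℤ G (π f)⁻¹ • fox π f) := by
  have h := fox_mul π f⁻¹ f
  rw [inv_mul_cancel, fox_one, map_inv] at h
  exact eq_neg_of_add_eq_zero_left h.symm

/-- The Fox derivatives of a consequence of the relators are combinations of those of the
relators. -/
lemma fox_mem_span {R : Set (FreeGroup α)} (hR : ∀ f ∈ R, π f = 1) {f : FreeGroup α}
    (hf : f ∈ Subgroup.normalClosure R) :
    fox π f ∈ Submodule.span (MonoidAlgebra ℤ G) (fox π '' R) := by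
  -- The condition `π f = 1` is carried along for the sake of normality: it makes the contributions
  -- of `g` and `g⁻¹` to the derivative of `g f g⁻¹` cancel.
  let N : Subgroup (FreeGroup α) :=
    { carrier := {f | π f = 1 ∧ fox π f ∈ Submodule.span (MonoidAlgebra ℤ G) (fox π '' R)}
      one_mem' := ⟨map_one π, by rw [fox_one]; exact zero_mem _⟩
      mul_mem' := fun {f g} hf hg => ⟨by rw [map_mul, hf.1, hg.1, one_mul], by
        rw [fox_mul]; exact add_mem hf.2 (Submodule.smul_mem _ _ hg.2)⟩
      inv_mem' := fun {f} hf => ⟨by rw [map_inv, hf.1, inv_one], by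
        rw [fox_inv]; exact neg_mem (Submodule.smul_mem _ _ hf.2)⟩ }
  have hN : N.Normal := ⟨fun f hf g => ⟨by rw [map_mul, map_mul, hf.1, mul_one, map_inv,
    mul_inv_cancel], by
      rw [fox_mul, fox_mul, map_mul, hf.1, mul_one, fox_inv, smul_neg, smul_smul, ← map_mul,
        mul_inv_cancel, map_one, one_smul, add_neg_cancel_comm]
      exact Submodule.smul_mem _ _ hf.2⟩⟩
  have hle : Subgroup.normalClosure R ≤ N := Subgroup.normalClosure_le_normal fun f hf =>
    ⟨hR f hf, Submodule.subset_span ⟨f, hf, rfl⟩⟩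
  exact (hle hf).2

lemma fox_mk (w : List (α × Bool)) : fox π (FreeGroup.mk w) =
    ∑ p : Fin w.length, MonoidAlgebra.of ℤ G (π (FreeGroup.mk (w.take p))) •
      fox π (FreeGroup.mk [w.get p]) := by
  induction w with
  | nil => rw [← FreeGroup.one_eq_mk, fox_one]; rfl
  | cons l w ih =>
    have h : FreeGroup.mk (l :: w) = FreeGroup.mk [l] * FreeGroup.mk w := by
      rw [FreeGroup.mul_mk]; rfl
    rw [h, fox_mul, ih, Finset.smul_sum]
    refine Eq.trans ?_ (Fin.sum_univ_succ _).symm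
    congr 1
    · change _ = MonoidAlgebra.of ℤ G (π (FreeGroup.mk [])) • fox π (FreeGroup.mk [l])
      rw [← FreeGroup.one_eq_mk, map_one, map_one, one_smul]
    · refine Finset.sum_congr rfl fun p _ => ?_
      have h' : FreeGroup.mk ((l :: w).take (p.succ : ℕ)) =
          FreeGroup.mk [l] * FreeGroup.mk (w.take p) := by
        rw [FreeGroup.mul_mk]; rfl
      rw [h', map_mul, map_mul, smul_smul]
      rfl

open CyclicWord in
/-- The Fox derivatives of a relator in terms of the vertices over which its edges start. -/
lemma fox_relator {w : List (α × Bool)} (hw : π (FreeGroup.mk w) = 1) :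
    fox π (FreeGroup.mk w) = ∑ p : Fin w.length, Pi.single (w.get p).1
      (MonoidAlgebra.single (vertex π w (tail w p)) (if (w.get p).2 = true then 1 else -1)) := by
  rw [fox_mk]
  refine Finset.sum_congr rfl fun p _ => ?_
  -- The derivative of `x⁻¹` is `-x⁻¹`, so an inverse letter contributes at its end vertex; in both
  -- cases this is the tail.
  cases hp : (w.get p).2
  · have h : FreeGroup.mk [w.get p] = (FreeGroup.of (w.get p).1)⁻¹ := by
      rw [← Prod.mk.eta (p := w.get p), hp]; rfl
    rw [h, fox_of_inv, tail_of_neg hp, vertex_next_of_neg hw hp, smul_neg, smul_smul, ← map_mul,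
      ← Pi.single_smul, ← Pi.single_neg]
    simp [MonoidAlgebra.of_apply, vertex, label]
  · have h : FreeGroup.mk [w.get p] = FreeGroup.of (w.get p).1 := by
      rw [← Prod.mk.eta (p := w.get p), hp]; rfl
    rw [h, fox_of, tail_of_pos hp, ← Pi.single_smul]
    simp [MonoidAlgebra.of_apply, vertex, label]

end Fox

/-! ### Heights in the group ring and the parity obstruction -/

section GroupRing

variable {G : Type*} [Group G] (χ : Additive G →+ ℤ)

/-- The elements of the group ring supported in heights at least `m`. -/
def heightGE (m : ℤ) : AddSubgroup (MonoidAlgebra ℤ G) where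
  carrier := {x | ∀ g, x.coeff g ≠ 0 → m ≤ height χ g}
  zero_mem' := fun g hg => absurd rfl hg
  add_mem' := fun {x y} hx hy g hg => by
    by_cases h : x.coeff g = 0
    · exact hy g fun h' => hg (by rw [MonoidAlgebra.coeff_add, Finsupp.add_apply, h, h', add_zero])
    · exact hx g h
  neg_mem' := fun {x} hx g hg => hx g fun h => hg (by
    rw [MonoidAlgebra.coeff_neg, Finsupp.neg_apply, h, neg_zero])

variable {χ}

lemma heightGE_mono {m m' : ℤ} (h : m ≤ m') {x : MonoidAlgebra ℤ G} (hx : x ∈ heightGE χ m') :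
    x ∈ heightGE χ m := fun g hg => h.trans (hx g hg)

lemma mul_mem_heightGE {m m' : ℤ} {x y : MonoidAlgebra ℤ G} (hx : x ∈ heightGE χ m)
    (hy : y ∈ heightGE χ m') : x * y ∈ heightGE χ (m + m') := by
  classical
  intro g hg
  have := MonoidAlgebra.support_coeff_mul_subset x y (Finsupp.mem_support_iff.2 hg)
  obtain ⟨a, ha, b, hb, rfl⟩ := Finset.mem_mul.1 this
  rw [height_mul]
  exact add_le_add (hx a (Finsupp.mem_support_iff.1 ha)) (hy b (Finsupp.mem_support_iff.1 hb))

lemma single_mem_heightGE {m : ℤ} {g : G} (h : m ≤ height χ g) (k : ℤ) :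
    MonoidAlgebra.single g k ∈ heightGE χ m := by
  classical
  intro a ha
  rw [MonoidAlgebra.coeff_single, Finsupp.single_apply] at ha
  split_ifs at ha with hga
  · exact hga ▸ h
  · exact absurd rfl ha

lemma one_mem_heightGE : (1 : MonoidAlgebra ℤ G) ∈ heightGE χ 0 := by
  rw [MonoidAlgebra.one_def]
  exact single_mem_heightGE (height_one χ).ge 1

lemma exists_mem_heightGE (χ : Additive G →+ ℤ) (x : MonoidAlgebra ℤ G) :
    ∃ m, x ∈ heightGE χ m := by
  classical
  obtain ⟨m, hm⟩ := (x.coeff.support.image (height χ)).bddBelow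
  exact ⟨m, fun g hg => hm (Finset.mem_coe.2
    (Finset.mem_image_of_mem _ (Finsupp.mem_support_iff.2 hg)))⟩

lemma exists_forall_mem_heightGE {ι : Type*} [Finite ι] (χ : Additive G →+ ℤ)
    (x : ι → MonoidAlgebra ℤ G) : ∃ m, ∀ i, x i ∈ heightGE χ m := by
  choose m hm using fun i => exists_mem_heightGE χ (x i)
  obtain ⟨M, hM⟩ := Finite.exists_ge m
  exact ⟨M, fun i => heightGE_mono (hM i) (hm i)⟩

/-- An element supported in heights at least `m` has a part of height exactly `m`. -/
lemma exists_lowest_part {m : ℤ} {x : MonoidAlgebra ℤ G} (hx : x ∈ heightGE χ m) :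
    ∃ y, y ∈ heightGE χ m ∧ y ∈ heightGE (-χ) (-m) ∧ x - y ∈ heightGE χ (m + 1) := by
  classical
  have key (g : G) : (MonoidAlgebra.ofCoeff (x.coeff.filter fun g => height χ g = m)).coeff g =
      if height χ g = m then x.coeff g else 0 := Finsupp.filter_apply ..
  refine ⟨MonoidAlgebra.ofCoeff (x.coeff.filter fun g => height χ g = m), fun g hg => ?_,
    fun g hg => ?_, fun g hg => ?_⟩
  · rw [key] at hg
    split_ifs at hg with h
    · exact h.ge
    · exact absurd rfl hg
  · rw [key] at hg
    split_ifs at hg with h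
    · rw [height_neg, h]
    · exact absurd rfl hg
  · rw [MonoidAlgebra.coeff_sub, Finsupp.sub_apply, key] at hg
    split_ifs at hg with h
    · exact absurd (sub_self _) hg
    · rw [sub_zero] at hg
      exact Int.add_one_le_of_lt (lt_of_le_of_ne (hx g hg) (Ne.symm h))

/-- Membership in `heightGE (-χ) (-m)` means support in heights at most `m`, so the two supports are
disjoint. -/
lemma eq_zero_of_mem_heightGE {m : ℤ} {x : MonoidAlgebra ℤ G} (hx : x ∈ heightGE χ (m + 1))
    (hx' : x ∈ heightGE (-χ) (-m)) : x = 0 := by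
  ext g
  by_contra h
  have h1 := hx g h
  have h2 := hx' g h
  rw [height_neg] at h2
  lia

/-- The augmentation of the group ring. -/
noncomputable def augmentation (G : Type*) [Group G] : MonoidAlgebra ℤ G →+* ℤ :=
  MonoidAlgebra.liftNCRingHom (RingHom.id ℤ) (1 : G →* ℤ) fun _ _ => Commute.all _ _

lemma augmentation_single (g : G) (k : ℤ) :
    augmentation G (MonoidAlgebra.single g k) = k := by
  simp [augmentation]

/-- Integer coefficients are needed because the final contradiction is one of parity. -/
lemma noZeroDivisors_int (hQ : NoZeroDivisors (MonoidAlgebra ℚ G)) :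
    NoZeroDivisors (MonoidAlgebra ℤ G) :=
  Function.Injective.noZeroDivisors (MonoidAlgebra.mapRingHom G (Int.castRingHom ℚ))
    (MonoidAlgebra.map_injective _ Int.cast_injective) (map_zero _) (map_mul _)

/-- A square matrix over the group ring whose lowest part is diagonal, without zero on the
diagonal, does not have the `j`-th unit vector in its row space, even modulo positive heights,
if the augmentation of its `j`-th lowest entry is even. -/
lemma false_of_lowest_part_even [NoZeroDivisors (MonoidAlgebra ℤ G)] {ι : Type*} [Fintype ι]
    [DecidableEq ι] {B : ι → ι → MonoidAlgebra ℤ G} {d : ι → MonoidAlgebra ℤ G}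
    (hd : ∀ i, d i ≠ 0) (hd₀ : ∀ i, d i ∈ heightGE χ 0) (hd₁ : ∀ i, d i ∈ heightGE (-χ) 0)
    (hB : ∀ k i, B k i - (if k = i then d i else 0) ∈ heightGE χ 1) {j : ι}
    (hj : Even (augmentation G (d j))) {c : ι → MonoidAlgebra ℤ G}
    (hc : ∀ i, ∑ k, c k * B k i + (if i = j then 1 else 0) ∈ heightGE χ 1) : False := by
  -- Only row `i` reaches height 0 in column `i`, so at height `m` the sum is `y * d i`, with `y`
  -- the part of `c i` at that height.
  have lowest {m : ℤ} (hm : ∀ k, c k ∈ heightGE χ m) (i : ι) {y : MonoidAlgebra ℤ G}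
      (hy : c i - y ∈ heightGE χ (m + 1)) :
      ∑ k, c k * B k i - y * d i ∈ heightGE χ (m + 1) := by
    have e : ∑ k, c k * B k i - y * d i =
        ∑ k, c k * (B k i - if k = i then d i else 0) + (c i - y) * d i := by
      simp only [mul_sub, Finset.sum_sub_distrib, mul_ite, mul_zero, Finset.sum_ite_eq',
        Finset.mem_univ, if_true, sub_mul]
      abel
    rw [e]
    exact add_mem (sum_mem fun k _ => mul_mem_heightGE (hm k) (hB k i))
      (by simpa using mul_mem_heightGE hy (hd₀ i))
  -- Below height 0 there is nothing to match `y * d i`, so it vanishes; the absence of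
  -- zero-divisors then gives `y = 0`.
  have up (m : ℤ) (hm0 : m < 0) (hm : ∀ k, c k ∈ heightGE χ m) :
      ∀ k, c k ∈ heightGE χ (m + 1) := by
    intro i
    obtain ⟨y, -, hy₁, hy⟩ := exists_lowest_part (hm i)
    have h1 := lowest hm i hy
    have h2 : (if i = j then 1 else 0 : MonoidAlgebra ℤ G) ∈ heightGE χ (m + 1) := by
      split_ifs
      · exact heightGE_mono (by lia) one_mem_heightGE
      · exact zero_mem _
    have h3 : y * d i ∈ heightGE χ (m + 1) := by
      have := sub_mem (sub_mem (heightGE_mono (by lia) (hc i)) h2) h1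
      simpa using this
    have h4 := eq_zero_of_mem_heightGE h3 (by simpa using mul_mem_heightGE hy₁ (hd₁ i))
    rw [(mul_eq_zero.1 h4).resolve_right (hd i), sub_zero] at hy
    exact hy
  have h0 : ∀ k, c k ∈ heightGE χ 0 := by
    obtain ⟨m, hm⟩ := exists_forall_mem_heightGE χ c
    rcases le_total 0 m with h | h
    · exact fun k => heightGE_mono h (hm k)
    · obtain ⟨N, rfl⟩ : ∃ N : ℕ, m = -N := ⟨m.natAbs, by lia⟩
      induction N with
      | zero => simpa using hm
      | succ N ih =>
        refine ih ?_ (by lia)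
        have := up _ (by push_cast; lia) hm
        rwa [Nat.cast_succ, neg_add, neg_add_cancel_right] at this
  -- At height 0 the unit vector must be matched: `y * d j = -1`, whose augmentation is odd, while
  -- that of the left side is even.
  obtain ⟨y, -, hy₁, hy⟩ := exists_lowest_part (h0 j)
  have h1 := lowest h0 j hy
  have h2 : y * d j + 1 ∈ heightGE χ (0 + 1) := by
    have := sub_mem (hc j) h1
    rw [if_pos rfl] at this
    rwa [add_sub_right_comm, sub_sub_cancel] at this
  have h3 : y * d j + 1 ∈ heightGE (-χ) (-0) :=
    add_mem (by simpa using mul_mem_heightGE hy₁ (hd₁ j)) one_mem_heightGE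
  have h4 := congrArg (augmentation G) (eq_zero_of_mem_heightGE h2 h3)
  rw [map_add, map_mul, map_one, map_zero] at h4
  have := hj.mul_left (augmentation G y)
  rw [eq_neg_of_add_eq_zero_left h4] at this
  simp at this

end GroupRing

/-! ### Relations obtained from connectedness -/

section Connected

variable {α : Type*} [DecidableEq α] {G : Type*} [Group G] {π : FreeGroup α →* G}
  {χ : Additive G →+ ℤ}

/-- If the part of the Cayley graph in non-negative heights is connected, then its vertices are
joined to `1` by words with Fox derivatives supported in heights bounded from below. -/
lemma exists_fox_mem_heightGE [Finite α] (hπ : Function.Surjective π) {S : Set G}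
    (hS : S.Finite)
    (hconn : ((SimpleGraph.mulCayley S).induce {g : G | 0 ≤ height χ g}).Connected) :
    ∃ C : ℤ, ∀ h, 0 ≤ height χ h → ∃ f, π f = h ∧ ∀ i, fox π f i ∈ heightGE χ C := by
  have := hS.to_subtype
  -- `S` need not consist of the given generators, so each of its elements is spelled by a chosen
  -- word; finiteness of `S` and `α` makes the bound uniform.
  choose F hF using hπ
  obtain ⟨C₁, hC₁⟩ := exists_forall_mem_heightGE χ fun s : S × α => fox π (F s.1) s.2
  obtain ⟨C₂, hC₂⟩ := exists_forall_mem_heightGE χ fun s : S × α => fox π (F s.1)⁻¹ s.2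
  refine ⟨min C₁ C₂, fun h hh => ?_⟩
  have hr := (SimpleGraph.reachable_iff_reflTransGen _ _).1
    (hconn.preconnected ⟨1, (height_one χ).ge⟩ ⟨h, hh⟩)
  generalize hz : (⟨h, hh⟩ : {g : G | 0 ≤ height χ g}) = z at hr
  suffices ∃ f, π f = z ∧ ∀ i, fox π f i ∈ heightGE χ (min C₁ C₂) by rwa [← hz] at this
  clear hz
  induction hr with
  | refl => exact ⟨1, map_one π, fun i => by rw [fox_one]; exact zero_mem _⟩
  | @tail b c _ hbc ih =>
    obtain ⟨f, hf, hfm⟩ := ih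
    -- The product rule translates the derivative of the appended word by a vertex of non-negative
    -- height, so the bound survives.
    have ext (f' : FreeGroup α) (h : ∀ i, fox π f' i ∈ heightGE χ (min C₁ C₂)) (i : α) :
        fox π (f * f') i ∈ heightGE χ (min C₁ C₂) := by
      rw [fox_mul, hf]
      refine add_mem (hfm i) ?_
      have hb : (0 : ℤ) ≤ height χ b.1 := b.2
      exact heightGE_mono (by lia)
        (mul_mem_heightGE (single_mem_heightGE (le_refl (height χ b.1)) 1) (h i))
    rw [SimpleGraph.comap_adj, SimpleGraph.mulCayley_adj'] at hbc
    obtain ⟨-, s, hs, h | h⟩ := hbc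
    · exact ⟨f * F s, by rw [map_mul, hf, hF]; exact h,
        ext _ fun i => heightGE_mono (min_le_left _ _) (hC₁ (⟨s, hs⟩, i))⟩
    · refine ⟨f * (F s)⁻¹, ?_,
        ext _ fun i => heightGE_mono (min_le_right _ _) (hC₂ (⟨s, hs⟩, i))⟩
      rw [map_mul, map_inv, hf, hF]
      exact mul_inv_eq_of_eq_mul h

/-- If the part of the Cayley graph in non-negative heights is connected and `b` has negative
height, then the row space of the Fox matrix without the column `b` contains every unit vector
up to an error in positive heights. -/
lemma exists_relation_fox [Finite α] (hπ : Function.Surjective π) {S : Set G} (hS : S.Finite)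
    (hconn : ((SimpleGraph.mulCayley S).induce {g : G | 0 ≤ height χ g}).Connected)
    {a b : α} (hb : height χ (π (FreeGroup.of b)) < 0)
    (ha : 0 ≤ height χ (π (FreeGroup.of a))) :
    ∃ f, π f = 1 ∧ ∀ i, i ≠ b → fox π f i + (if i = a then 1 else 0) ∈ heightGE χ 1 := by
  obtain ⟨C, hC⟩ := exists_fox_mem_heightGE hπ hS hconn
  -- `V` has derivatives only in column `b`, and `V⁻¹` has height at least `|C| + 1`, which lifts
  -- the bound `C` to at least 1. The choice is possible because `C` does not depend on the vertex
  -- to be reached.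
  set V : FreeGroup α := FreeGroup.of b ^ (C.natAbs + 1) with hV
  have hVi (i : α) (hi : i ≠ b) : fox π V i = 0 := by
    rw [hV]
    induction C.natAbs + 1 with
    | zero => rw [pow_zero, fox_one]; rfl
    | succ k ih =>
      rw [pow_succ, fox_mul, Pi.add_apply, ih, Pi.smul_apply, fox_of, Pi.single_eq_of_ne hi,
        smul_zero, add_zero]
  have hVinv (i : α) (hi : i ≠ b) : fox π V⁻¹ i = 0 := by
    rw [fox_inv, Pi.neg_apply, Pi.smul_apply, hVi i hi, smul_zero, neg_zero]
  have hVheight : 1 ≤ height χ (π V⁻¹) + C := by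
    rw [hV, map_inv, map_pow, height_inv, height_pow]
    push_cast
    have := mul_le_mul_of_nonneg_left (Int.le_sub_one_of_lt hb) (by positivity : 0 ≤ |C| + 1)
    linarith [neg_abs_le C]
  -- The conjugate has the height of `a`, hence can be reached from `1` within the upper half.
  -- Conjugating back, `V⁻¹ f V` is another word for `a`, and dividing by `a` yields the relation.
  obtain ⟨f, hf, hfC⟩ := hC (π (V * FreeGroup.of a * V⁻¹)) (by
    rw [map_mul, map_mul, map_inv, height_mul, height_mul, height_inv]; lia)
  have hw : π (V⁻¹ * (f * V)) = π (FreeGroup.of a) := by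
    rw [map_mul, map_mul, hf, ← map_mul, ← map_mul]
    congr 1
    group
  refine ⟨V⁻¹ * (f * V) * (FreeGroup.of a)⁻¹, by rw [map_mul, hw, map_inv, mul_inv_cancel],
    fun i hi => ?_⟩
  have e : fox π (V⁻¹ * (f * V) * (FreeGroup.of a)⁻¹) i + (if i = a then 1 else 0) =
      MonoidAlgebra.single (π V⁻¹) 1 * fox π f i := by
    rw [fox_mul, hw, fox_of_inv, fox_mul, fox_mul, smul_neg, smul_smul, ← map_mul, mul_inv_cancel,
      map_one, one_smul, Pi.add_apply, Pi.add_apply, Pi.smul_apply, Pi.add_apply, Pi.smul_apply,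
      hVi i hi, hVinv i hi, smul_zero, add_zero, zero_add, Pi.neg_apply, Pi.single_apply,
      neg_add_cancel_right]
    rfl
  rw [e]
  exact heightGE_mono hVheight (mul_mem_heightGE (single_mem_heightGE le_rfl 1) (hfC i))

end Connected

/-! ### Lowest parts of the rows of the Fox matrix -/

namespace CyclicWord

section LowestPart

variable {α : Type*} [DecidableEq α] {G : Type*} [Group G] {π : FreeGroup α →* G}
  {χ : Additive G →+ ℤ} {w : List (α × Bool)}

/-- The contribution of the edge `p` of `C_w` to the Fox derivative with respect to its label. -/
noncomputable def edgeTerm (π : FreeGroup α →* G) (w : List (α × Bool)) (p : Fin w.length) :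
    MonoidAlgebra ℤ G :=
  MonoidAlgebra.single (vertex π w (tail w p)) (if (w.get p).2 = true then 1 else -1)

/-- Apart from the column `b`, the lowest part of the Fox derivatives of a relator comes from the
edges with minimal tail. -/
lemma fox_sub_mem_heightGE (hw : π (FreeGroup.mk w) = 1) {a b : α} {P : Finset (Fin w.length)}
    (ha : ∀ p ∈ P, (w.get p).1 = a)
    (hP : ∀ q, (w.get q).1 ≠ b →
      (tail w q ∈ lowerVertices (χ.comp (MonoidHom.toAdditive π)) w ↔ q ∈ P))
    {v : Fin w.length} (hv : v ∈ lowerVertices (χ.comp (MonoidHom.toAdditive π)) w)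
    {i : α} (hi : i ≠ b) :
    fox π (FreeGroup.mk w) i - (if i = a then ∑ p ∈ P, edgeTerm π w p else 0) ∈
      heightGE χ (height χ (vertex π w v) + 1) := by
  have e : (if i = a then ∑ p ∈ P, edgeTerm π w p else 0) =
      ∑ p, if p ∈ P ∧ i = a then edgeTerm π w p else 0 := by
    split_ifs with h
    · simp [h, Finset.sum_ite_mem]
    · simp [h]
  rw [e, fox_relator π hw, Finset.sum_apply, ← Finset.sum_sub_distrib]
  refine sum_mem fun p _ => ?_
  rw [Pi.single_apply]
  by_cases hpi : i = (w.get p).1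
  · rw [if_pos hpi]
    by_cases hp : p ∈ P
    · have h : p ∈ P ∧ i = a := ⟨hp, hpi.trans (ha p hp)⟩
      rw [if_pos h, edgeTerm, sub_self]
      exact zero_mem _
    · have h : ¬(p ∈ P ∧ i = a) := fun h => hp h.1
      rw [if_neg h, sub_zero]
      refine single_mem_heightGE (lt_of_notMem_lowerVertices hv fun h => hp ?_) _
      exact (hP p (hpi ▸ hi)).1 h
  · rw [if_neg hpi, if_neg fun h => hpi (h.2.trans (ha p h.1).symm), sub_zero]
    exact zero_mem _

/-- The relator `w`, translated by `g`, contributes a row to the Fox matrix with lowest part `d`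
in the column `a` and `0` in the other columns except `b`. -/
def IsLowestPart (π : FreeGroup α →* G) (χ : Additive G →+ ℤ) (w : List (α × Bool)) (a b : α)
    (g : G) (d : MonoidAlgebra ℤ G) : Prop :=
  d ≠ 0 ∧ d ∈ heightGE χ 0 ∧ d ∈ heightGE (-χ) 0 ∧
    ∀ i, i ≠ b → MonoidAlgebra.single g 1 * fox π (FreeGroup.mk w) i - (if i = a then d else 0) ∈
      heightGE χ 1

/-- The edges in `P` have their tails at the minimum; translating one of these tails to `1` puts all
of them at height 0 and every other term outside column `b` higher. -/
lemma isLowestPart_sum (hw : π (FreeGroup.mk w) = 1) {a b : α} {P : Finset (Fin w.length)}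
    (hab : a ≠ b) (ha : ∀ p ∈ P, (w.get p).1 = a)
    (hP : ∀ q, (w.get q).1 ≠ b →
      (tail w q ∈ lowerVertices (χ.comp (MonoidHom.toAdditive π)) w ↔ q ∈ P))
    {p₀ : Fin w.length} (hp₀ : p₀ ∈ P)
    (hne : ∑ p ∈ P, MonoidAlgebra.single ((vertex π w (tail w p₀))⁻¹ * vertex π w (tail w p))
      (if (w.get p).2 = true then (1 : ℤ) else -1) ≠ 0) :
    IsLowestPart π χ w a b (vertex π w (tail w p₀))⁻¹
      (∑ p ∈ P, MonoidAlgebra.single ((vertex π w (tail w p₀))⁻¹ * vertex π w (tail w p))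
        (if (w.get p).2 = true then (1 : ℤ) else -1)) := by
  have hlow (p) (hp : p ∈ P) : tail w p ∈ lowerVertices (χ.comp (MonoidHom.toAdditive π)) w :=
    (hP p (by rwa [ha p hp])).2 hp
  have hlevel (p) (hp : p ∈ P) :
      height χ ((vertex π w (tail w p₀))⁻¹ * vertex π w (tail w p)) = 0 := by
    rw [height_mul, height_inv, neg_add_eq_zero]
    exact le_antisymm (hlow p₀ hp₀ _) (hlow p hp _)
  refine ⟨hne, sum_mem fun p hp => single_mem_heightGE (hlevel p hp).ge _,
    sum_mem fun p hp => single_mem_heightGE ?_ _, fun i hi => ?_⟩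
  · rw [height_neg, hlevel p hp, neg_zero]
  · have e : (if i = a then ∑ p ∈ P, MonoidAlgebra.single
        ((vertex π w (tail w p₀))⁻¹ * vertex π w (tail w p))
        (if (w.get p).2 = true then (1 : ℤ) else -1) else 0) =
        MonoidAlgebra.single (vertex π w (tail w p₀))⁻¹ 1 *
          (if i = a then ∑ p ∈ P, edgeTerm π w p else 0) := by
      rw [mul_ite, mul_zero, Finset.mul_sum]
      simp only [edgeTerm, MonoidAlgebra.single_mul_single, one_mul]
    rw [e, ← mul_sub]
    have := mul_mem_heightGE (single_mem_heightGE (le_refl (height χ (vertex π w (tail w p₀))⁻¹)) 1)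
      (fox_sub_mem_heightGE hw ha hP (hlow p₀ hp₀) hi)
    rwa [height_inv, neg_add_cancel_left] at this

lemma HasUniqueMinimum.exists_isLowestPart {a b : α} (hw : π (FreeGroup.mk w) = 1) (hab : a ≠ b)
    (ha : 0 ≤ height χ (π (FreeGroup.of a)))
    (h : HasUniqueMinimum (χ.comp (MonoidHom.toAdditive π)) a b w) :
    ∃ g d, IsLowestPart π χ w a b g d := by
  obtain ⟨p, hp, h⟩ := h.exists_edge hw ha
  refine ⟨_, _, isLowestPart_sum (P := {p}) hw hab (by simpa using hp) (by simpa using h)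
    (Finset.mem_singleton_self p) ?_⟩
  rw [Finset.sum_singleton, Ne, MonoidAlgebra.single_eq_zero]
  split_ifs <;> decide

/-- The lowest part is `±1 ± g`, with `g` the quotient of the two tails. Equal signs cannot cancel,
opposite signs cancel only if `g = 1`, and in every case the augmentation is `0` or `±2`. -/
lemma HasRepeatedMinimum.exists_isLowestPart {a b : α} (hw : π (FreeGroup.mk w) = 1)
    (hab : a ≠ b) (ha : 0 ≤ height χ (π (FreeGroup.of a)))
    (h : HasRepeatedMinimum (χ.comp (MonoidHom.toAdditive π)) a b w)
    (hopp : OppositeMinimaDistinct π (χ.comp (MonoidHom.toAdditive π)) w) :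
    ∃ g d, IsLowestPart π χ w a b g d ∧ Even (augmentation G d) := by
  obtain ⟨p, q, hpq, hp, hq, h, hne⟩ := h.exists_edges hw hab ha hopp
  refine ⟨_, _, isLowestPart_sum (P := {p, q}) hw hab (by simpa using ⟨hp, hq⟩) (by simpa using h)
    (Finset.mem_insert_self p _) ?_, ?_⟩
  · rw [Finset.sum_pair hpq, inv_mul_cancel]
    intro h0
    -- The coefficient at `1` suffices: the first term always contributes to it, and the second
    -- cancels it only if the signs differ and the tails coincide.
    have h1 := congrArg (fun x => x.coeff 1) h0
    simp only [MonoidAlgebra.coeff_add, MonoidAlgebra.coeff_single, Finsupp.add_apply,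
      Finsupp.single_eq_same, MonoidAlgebra.coeff_zero, Finsupp.zero_apply] at h1
    by_cases hs : (w.get p).2 = (w.get q).2
    · rw [hs] at h1
      classical
      rw [Finsupp.single_apply] at h1
      split_ifs at h1 <;> omega
    · rw [Finsupp.single_eq_of_ne] at h1
      · split_ifs at h1 <;> omega
      · intro h2
        exact hne hs (inv_mul_eq_one.1 h2.symm)
  · rw [Finset.sum_pair hpq, map_add, augmentation_single, augmentation_single]
    split_ifs <;> decide

end LowestPart

end CyclicWord

/-! ### The two statements for deficiency 1 presentations -/

section DeficiencyOne

open CyclicWord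

variable {n : ℕ} {r : Fin n → List (Fin (n + 1) × Bool)} {φ : Additive (DeficiencyOneGroup r) →+ ℤ}

lemma mk_relator (i : Fin n) : PresentedGroup.mk (relatorSet r) (FreeGroup.mk (r i)) = 1 :=
  PresentedGroup.one_of_mem ⟨i, rfl⟩

lemma mem_bnsInvariant_iff : (Int.castAddHom ℝ).comp φ ∈ BNSInvariant (DeficiencyOneGroup r) ↔
    φ ≠ 0 ∧ ∃ S : Set (DeficiencyOneGroup r), S.Finite ∧ Subgroup.closure S = ⊤ ∧
      ((SimpleGraph.mulCayley S).induce {g | 0 ≤ height φ g}).Connected := by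
  have h : {g : DeficiencyOneGroup r | 0 ≤ (Int.castAddHom ℝ).comp φ (Additive.ofMul g)} =
      {g | 0 ≤ height φ g} := by
    ext g
    exact Int.cast_nonneg_iff (R := ℝ)
  have h0 : (Int.castAddHom ℝ).comp φ ≠ 0 ↔ φ ≠ 0 := by
    refine not_congr ⟨fun h => AddMonoidHom.ext fun g => ?_,
      fun h => by rw [h, AddMonoidHom.comp_zero]⟩
    exact Int.cast_eq_zero.1 (DFunLike.congr_fun h g : ((φ g : ℤ) : ℝ) = 0)
  rw [BNSInvariant, Set.mem_ofPred_eq, h, h0]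

theorem mem_bnsInvariant_of_uniqueMinimumCondition
    (h : UniqueMinimumCondition r (liftToFree φ)) :
    (Int.castAddHom ℝ).comp φ ∈ BNSInvariant (DeficiencyOneGroup r) := by
  obtain ⟨-, ρ, σ, hpos, hneg, -, hmin⟩ := h
  rw [mem_bnsInvariant_iff]
  refine ⟨fun h0 => ?_, _, Set.finite_range _, PresentedGroup.closure_range_of _,
    connected_mulCayley (π := PresentedGroup.mk (relatorSet r)) fun g h hg hh =>
      pathAbove_zero (PresentedGroup.mk_surjective _) (b := ρ (Fin.last n)) hneg
        (fun a ha => ?_) hg hh⟩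
  · rw [h0] at hneg
    exact lt_irrefl _ hneg
  · obtain ⟨i, rfl⟩ := ρ.surjective a
    obtain ⟨i, rfl⟩ := Fin.exists_castSucc_eq.2 fun h => ha (congrArg ρ h)
    exact HasUniqueMinimum.pathAbove (mk_relator (σ i)) ha (hpos i) hneg (hmin i)

theorem notMem_bnsInvariant_of_repeatedMinimumCondition
    (hQ : NoZeroDivisors (MonoidAlgebra ℚ (DeficiencyOneGroup r)))
    (h : RepeatedMinimumCondition r (liftToFree φ))
    (hopp : ∀ i, OppositeMinimaDistinct (PresentedGroup.mk (relatorSet r)) (liftToFree φ) (r i)) :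
    (Int.castAddHom ℝ).comp φ ∉ BNSInvariant (DeficiencyOneGroup r) := by
  obtain ⟨-, ρ, σ, hpos, hneg, -, j, hj, hmin⟩ := h
  rw [mem_bnsInvariant_iff]
  rintro ⟨-, S, hS, -, hconn⟩
  have hZ := noZeroDivisors_int hQ
  have hne (i : Fin n) : ρ i.castSucc ≠ ρ (Fin.last n) :=
    ρ.injective.ne (Fin.castSucc_lt_last i).ne
  have hrow (i : Fin n) : ∃ g d, IsLowestPart (PresentedGroup.mk (relatorSet r)) φ (r (σ i))
      (ρ i.castSucc) (ρ (Fin.last n)) g d ∧ (i = j → Even (augmentation _ d)) := by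
    by_cases hij : i = j
    · subst hij
      obtain ⟨g, d, h, he⟩ := HasRepeatedMinimum.exists_isLowestPart (mk_relator (σ i)) (hne i)
        (hpos i) hj (hopp (σ i))
      exact ⟨g, d, h, fun _ => he⟩
    · obtain ⟨g, d, h⟩ := HasUniqueMinimum.exists_isLowestPart (mk_relator (σ i)) (hne i)
        (hpos i) (hmin i hij)
      exact ⟨g, d, h, fun h => absurd h hij⟩
  choose g d hd he using hrow
  obtain ⟨f, hf, hfox⟩ := exists_relation_fox (PresentedGroup.mk_surjective (relatorSet r)) hS
    hconn hneg (hpos j)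
  -- Translating the rows by the units `g k` and permuting them by `σ` does not shrink the row
  -- space.
  have hspan : fox (PresentedGroup.mk (relatorSet r)) f ∈
      Submodule.span (MonoidAlgebra ℤ (DeficiencyOneGroup r)) (Set.range fun k : Fin n =>
        MonoidAlgebra.single (g k) (1 : ℤ) •
          fox (PresentedGroup.mk (relatorSet r)) (FreeGroup.mk (r (σ k)))) := by
    refine Submodule.span_le.2 ?_ (fox_mem_span _ (fun f hf => PresentedGroup.one_of_mem hf)
      (PresentedGroup.mk_eq_one_iff.1 hf))
    rintro - ⟨-, ⟨i, rfl⟩, rfl⟩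
    obtain ⟨k, rfl⟩ := σ.surjective i
    have := Submodule.smul_mem _ (MonoidAlgebra.single (g k)⁻¹ (1 : ℤ)) (Submodule.subset_span
      (R := MonoidAlgebra ℤ (DeficiencyOneGroup r)) (Set.mem_range_self (f := fun k : Fin n =>
        MonoidAlgebra.single (g k) (1 : ℤ) •
          fox (PresentedGroup.mk (relatorSet r)) (FreeGroup.mk (r (σ k)))) k))
    rwa [smul_smul, MonoidAlgebra.single_mul_single, inv_mul_cancel, one_mul,
      ← MonoidAlgebra.one_def, one_smul] at this
  obtain ⟨c, hc⟩ := (Submodule.mem_span_range_iff_exists_fun _).1 hspan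
  -- Dropping the column of the descending generator leaves a square matrix; `ρ` and `σ` match
  -- columns with relators so that its lowest part is diagonal.
  refine false_of_lowest_part_even (χ := φ) (B := fun k i => MonoidAlgebra.single (g k) (1 : ℤ) *
    fox (PresentedGroup.mk (relatorSet r)) (FreeGroup.mk (r (σ k))) (ρ i.castSucc))
    (d := d) (c := c) (j := j) (fun i => (hd i).1) (fun i => (hd i).2.1) (fun i => (hd i).2.2.1)
    (fun k i => ?_) (he j rfl) fun i => ?_
  · have := (hd k).2.2.2 _ (hne i)
    by_cases hki : k = i
    · subst hki
      rwa [if_pos rfl] at this ⊢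
    · rw [if_neg fun h => hki (Fin.castSucc_injective n (ρ.injective h)).symm] at this
      rwa [if_neg hki]
  · have := hfox _ (hne i)
    rw [← hc, Finset.sum_apply] at this
    by_cases hij : i = j
    · subst hij
      rwa [if_pos rfl] at this ⊢
    · rw [if_neg fun h => hij (Fin.castSucc_injective n (ρ.injective h))] at this
      rwa [if_neg hij]

end DeficiencyOne

theorem mainTheorem7 (n : ℕ) (r : Fin n → List (Fin (n + 1) × Bool))
    (hr : ∀ i, r i ≠ [] ∧ FreeGroup.IsReduced (r i))
    (hQ : NoZeroDivisors (MonoidAlgebra ℚ (DeficiencyOneGroup r)))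
    (φ : Additive (DeficiencyOneGroup r) →+ ℤ) :
    (UniqueMinimumCondition r (liftToFree φ) →
      (Int.castAddHom ℝ).comp φ ∈ BNSInvariant (DeficiencyOneGroup r)) ∧
    (RepeatedMinimumCondition r (liftToFree φ) →
      (∀ i, CyclicWord.OppositeMinimaDistinct (PresentedGroup.mk (relatorSet r))
        (liftToFree φ) (r i)) →
      (Int.castAddHom ℝ).comp φ ∉ BNSInvariant (DeficiencyOneGroup r)) :=
  ⟨mem_bnsInvariant_of_uniqueMinimumCondition,
    notMem_bnsInvariant_of_repeatedMinimumCondition hQ⟩
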